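/- Let $G$ be a Polish group and let $(U_m)_{m\in\mathbb N}$ be a neighbourhood basis of the identity $e\in G$ such that $U_m^{-1}=U_m$ and $U_{m+1}U_{m+1}\subset U_m$ for every $m$. Let $(X,\mu)$ be a standard Borel probability space with measure algebra $\mathcal X$ (Borel sets modulo $\mu$-null sets). Give the group $\mathrm{Aut}(\mathcal X,\mu)$ of measure-preserving Boolean automorphisms the topology generated by the left translates of the sets $\{T:\mu(A\triangle TA)<\varepsilon\}$, where $A\in\mathcal X$ and $\varepsilon>0$. Let $G$ act on $\mathcal X$ by a boolean action, that is, a continuous homomorphism $G\to\mathrm{Aut}(\mathcal X,\mu)$; such an action is called a boolean $G$-system. A real function $f\in L^\infty(\mu)$ is called $G$-continuous if $f\circ g_n\to f$ in the $L^\infty(\mu)$ norm for every sequence $g_n\to e$ in $G$, where $f\circ g$ is the element of $L^\infty(\mu)$ determined by $\{f\circ g\in B\}=g^{-1}\{f\in B\}$ for all Borel $B\subset\mathbb R$. Let $\mathcal D\subset\mathcal X$ be the sub-$\sigma$-algebra generated by the $G$-continuous functions, i.e. by the sets $\{f\in B\}$ with $f$ $G$-continuous and $B\subset\mathbb R$ Borel.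 For $A\in\mathcal X$ and $U\subset G$ let $UA=\bigcup_{\gamma\in U'}\gamma A\in\mathcal X$, where $U'$ is a countable dense subset of $U$ (for given $U$ and $A$, the result does not depend on the choice of $U'$), and let $\tilde A=\bigcap_m U_mA$. Call $A$ stable if $A=\emptyset$ or $\tilde A=A$, and let $\mathcal A\subset\mathcal X$ be the sub-$\sigma$-algebra generated by the stable elements. Then $\mathcal D=\mathcal A$. Moreover, the boolean $G$-system admits a spatial model if and only if $\mathcal X=\mathcal A$. Here a spatial model is a Borel action $G\times Y\to Y$ on a standard Borel probability space $(Y,\nu)$, each element of $G$ preserving $\nu$, together with a measure-preserving Boolean isomorphism from $\mathcal X$ onto the measure algebra of $(Y,\nu)$ that intertwines the action of $G$ on $\mathcal X$ with the induced action on the measure algebra of $(Y,\nu)$. -/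

import Mathlib

open MeasureTheory Filter Set
open scoped symmDiff Topology ENNReal Pointwise

universe u v w

namespace BooleanSystem

section Algebra

variable {X : Type u} [MeasurableSpace X]

/-- Equality of measurable sets up to a null set. -/
def nullSetoid (μ : Measure X) : Setoid {s : Set X // MeasurableSet s} where
  r s t := (s : Set X) =ᵐ[μ] (t : Set X)
  iseqv :=
    { refl := fun _ => ae_eq_rfl
      symm := fun h => h.symm
      trans := fun h k => h.trans k }

/-- The measure algebra of `μ`: measurable sets modulo null sets. -/
def MeasureAlgebra (μ : Measure X) : Type u := Quotient (nullSetoid μ)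

namespace MeasureAlgebra

variable {μ : Measure X}

/-- The class of a measurable set. -/
def mk (μ : Measure X) (s : Set X) (hs : MeasurableSet s) : MeasureAlgebra μ :=
  Quotient.mk (nullSetoid μ) ⟨s, hs⟩

/-- A measurable set representing an element of the measure algebra. -/
noncomputable def rep (a : MeasureAlgebra μ) : Set X := (Quotient.out a).1

theorem measurableSet_rep (a : MeasureAlgebra μ) : MeasurableSet a.rep := (Quotient.out a).2

theorem mk_rep (a : MeasureAlgebra μ) : mk μ a.rep a.measurableSet_rep = a := Quotient.out_eq a

theorem mk_eq_mk {s t : Set X} {hs : MeasurableSet s} {ht : MeasurableSet t} :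
    mk μ s hs = mk μ t ht ↔ s =ᵐ[μ] t :=
  ⟨fun h => Quotient.exact h, fun h => Quotient.sound h⟩

theorem ind {p : MeasureAlgebra μ → Prop} (h : ∀ s hs, p (mk μ s hs)) (a : MeasureAlgebra μ) :
    p a := by
  rw [← a.mk_rep]
  exact h _ _

/-- The Boolean algebra structure, by union, intersection and complement of representatives;
`a ≤ b` means that `a` is contained in `b` up to a null set. -/
noncomputable instance : BooleanAlgebra (MeasureAlgebra μ) where
  le := Quotient.lift₂ (fun s t => (s : Set X) ≤ᵐ[μ] (t : Set X))
    (fun _ _ _ _ h k => propext ⟨fun l => h.symm.le.trans (l.trans k.le),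
      fun l => h.le.trans (l.trans k.symm.le)⟩)
  sup := Quotient.map₂ (fun s t => ⟨(s : Set X) ∪ t, s.2.union t.2⟩)
    (fun _ _ h _ _ k => EventuallyEq.union h k)
  inf := Quotient.map₂ (fun s t => ⟨(s : Set X) ∩ t, s.2.inter t.2⟩)
    (fun _ _ h _ _ k => EventuallyEq.inter h k)
  compl := Quotient.map (fun s => ⟨(s : Set X)ᶜ, s.2.compl⟩) (fun _ _ h => EventuallyEq.compl h)
  top := mk μ univ MeasurableSet.univ
  bot := mk μ ∅ MeasurableSet.empty
  le_refl := ind fun _ _ => EventuallyLE.refl _ _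
  le_trans a b c := by
    induction a using ind; induction b using ind; induction c using ind
    exact fun h k => EventuallyLE.trans h k
  le_antisymm a b := by
    induction a using ind; induction b using ind
    exact fun h k => Quotient.sound (EventuallyLE.antisymm h k)
  le_sup_left a b := by
    induction a using ind; induction b using ind
    exact Eventually.of_forall fun _ h => Or.inl h
  le_sup_right a b := by
    induction a using ind; induction b using ind
    exact Eventually.of_forall fun _ h => Or.inr h
  sup_le a b c := by
    induction a using ind; induction b using ind; induction c using ind
    intro h k
    filter_upwards [h, k] with x hx kx hor
    exact hor.elim hx kx
  inf_le_left a b := by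
    induction a using ind; induction b using ind
    exact Eventually.of_forall fun _ h => h.1
  inf_le_right a b := by
    induction a using ind; induction b using ind
    exact Eventually.of_forall fun _ h => h.2
  le_inf a b c := by
    induction a using ind; induction b using ind; induction c using ind
    intro h k
    filter_upwards [h, k] with x hx kx ha
    exact ⟨hx ha, kx ha⟩
  le_sup_inf a b c := by
    induction a using ind; induction b using ind; induction c using ind
    refine Eventually.of_forall fun x h => ?_
    rcases h with ⟨h1 | h1, h2 | h2⟩
    · exact Or.inl h1
    · exact Or.inl h1
    · exact Or.inl h2
    · exact Or.inr ⟨h1, h2⟩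
  inf_compl_le_bot a := by
    induction a using ind
    exact Eventually.of_forall fun _ h => h.2 h.1
  top_le_sup_compl a := by
    induction a using ind
    exact Eventually.of_forall fun _ _ => Classical.em _
  le_top a := by
    induction a using ind
    exact Eventually.of_forall fun _ _ => trivial
  bot_le a := by
    induction a using ind
    exact Eventually.of_forall fun _ h => False.elim h

theorem mk_le_mk {s t : Set X} {hs : MeasurableSet s} {ht : MeasurableSet t} :
    mk μ s hs ≤ mk μ t ht ↔ s ≤ᵐ[μ] t := Iff.rfl

/-- The measure of an element of the measure algebra. -/
def meas : MeasureAlgebra μ → ℝ≥0∞ :=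
  Quotient.lift (fun s => μ (s : Set X)) fun _ _ h => measure_congr h

/-- Countable unions in the measure algebra. -/
noncomputable def union {ι : Type*} [Countable ι] (a : ι → MeasureAlgebra μ) : MeasureAlgebra μ :=
  mk μ (⋃ i, (a i).rep) (MeasurableSet.iUnion fun i => (a i).measurableSet_rep)

/-- Countable intersections in the measure algebra. -/
noncomputable def inter {ι : Type*} [Countable ι] (a : ι → MeasureAlgebra μ) : MeasureAlgebra μ :=
  mk μ (⋂ i, (a i).rep) (MeasurableSet.iInter fun i => (a i).measurableSet_rep)

theorem isLUB_union {ι : Type*} [Countable ι] (a : ι → MeasureAlgebra μ) :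
    IsLUB (range a) (union a) := by
  constructor
  · rintro _ ⟨i, rfl⟩
    conv_lhs => rw [← (a i).mk_rep]
    exact Eventually.of_forall fun x hx => mem_iUnion.2 ⟨i, hx⟩
  · intro b hb
    have h : ∀ i, (a i).rep ≤ᵐ[μ] b.rep := fun i => by
      rw [← mk_le_mk (hs := (a i).measurableSet_rep) (ht := b.measurableSet_rep), mk_rep, mk_rep]
      exact hb ⟨i, rfl⟩
    rw [← b.mk_rep]
    refine mk_le_mk.2 ?_
    filter_upwards [ae_all_iff.2 h] with x hx hxU
    obtain ⟨i, hi⟩ := mem_iUnion.1 hxU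
    exact hx i hi

theorem isGLB_inter {ι : Type*} [Countable ι] (a : ι → MeasureAlgebra μ) :
    IsGLB (range a) (inter a) := by
  constructor
  · rintro _ ⟨i, rfl⟩
    conv_rhs => rw [← (a i).mk_rep]
    exact Eventually.of_forall fun x hx => mem_iInter.1 hx i
  · intro b hb
    have h : ∀ i, b.rep ≤ᵐ[μ] (a i).rep := fun i => by
      rw [← mk_le_mk (hs := b.measurableSet_rep) (ht := (a i).measurableSet_rep), mk_rep, mk_rep]
      exact hb ⟨i, rfl⟩
    rw [← b.mk_rep]
    refine mk_le_mk.2 ?_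
    filter_upwards [ae_all_iff.2 h] with x hx hxb
    exact mem_iInter.2 fun i => hx i hxb

/-- A sub-σ-algebra of the measure algebra. -/
structure IsSigmaSubalgebra (S : Set (MeasureAlgebra μ)) : Prop where
  bot_mem : ⊥ ∈ S
  compl_mem : ∀ a ∈ S, aᶜ ∈ S
  union_mem : ∀ a : ℕ → MeasureAlgebra μ, (∀ n, a n ∈ S) → union a ∈ S

/-- The sub-σ-algebra of the measure algebra generated by a family of elements. -/
def sigmaGenerated (C : Set (MeasureAlgebra μ)) : Set (MeasureAlgebra μ) :=
  {a | ∀ S, IsSigmaSubalgebra S → C ⊆ S → a ∈ S}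

/-- The automorphism group of the measure algebra: Boolean automorphisms preserving the measure. -/
def aut (μ : Measure X) : Subgroup (MeasureAlgebra μ ≃o MeasureAlgebra μ) where
  carrier := {T | ∀ a, (T a).meas = a.meas}
  one_mem' := fun _ => rfl
  mul_mem' := fun {S T} hS hT a => (hS (T a)).trans (hT a)
  inv_mem' := fun {T} hT a => by
    have h := hT (T⁻¹ a)
    rw [RelIso.apply_inv_self] at h
    exact h.symm

/-- The topology of the automorphism group: the sets `{T | μ (S a ∆ T a) < ε}` form a subbasis;
these are the left translates by `S` of the sets `{T | μ (a ∆ T a) < ε}`. -/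
noncomputable instance (μ : Measure X) : TopologicalSpace (aut μ) :=
  TopologicalSpace.generateFrom
    {N | ∃ (S : aut μ) (a : MeasureAlgebra μ) (ε : ℝ≥0∞), 0 < ε ∧
      N = {T : aut μ | meas (S.1 a ∆ T.1 a) < ε}}

/-- The class `[{x | f x ∈ B}]` of a bounded measurable function `f` and a Borel set `B`. -/
noncomputable def level (f : Lp ℝ ∞ μ) (B : Set ℝ) (hB : MeasurableSet B) : MeasureAlgebra μ :=
  mk μ (f ⁻¹' B) ((Lp.stronglyMeasurable f).measurable hB)

/-- `h = f ∘ T` in `L^∞`, for an automorphism `T` of the measure algebra: for all Borel `B`,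
`{h ∈ B} = T⁻¹ {f ∈ B}`. -/
def IsComp (f : Lp ℝ ∞ μ) (T : aut μ) (h : Lp ℝ ∞ μ) : Prop :=
  ∀ (B : Set ℝ) (hB : MeasurableSet B), level h B hB = (T⁻¹).1 (level f B hB)

end MeasureAlgebra

end Algebra

section Dense

/-- A countable dense subset of a subset of a Polish space. -/
noncomputable def denseSubset {P : Type v} [TopologicalSpace P] [PolishSpace P] (U : Set P) : Set P :=
  (TopologicalSpace.IsSeparable.of_separableSpace U).exists_countable_dense_subset.choose

theorem denseSubset_spec {P : Type v} [TopologicalSpace P] [PolishSpace P] (U : Set P) :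
    denseSubset U ⊆ U ∧ (denseSubset U).Countable ∧ U ⊆ closure (denseSubset U) :=
  (TopologicalSpace.IsSeparable.of_separableSpace U).exists_countable_dense_subset.choose_spec

instance {P : Type v} [TopologicalSpace P] [PolishSpace P] (U : Set P) : Countable (denseSubset U) :=
  (denseSubset_spec U).2.1.to_subtype

end Dense

section Action

open MeasureAlgebra

variable {G : Type v} [Group G] [TopologicalSpace G] {X : Type u} [MeasurableSpace X]

/-- A boolean action of `G` on `(X, μ)`: a continuous homomorphism from `G` to the automorphism
group of the measure algebra. -/
abbrev BooleanAction (G : Type v) [Group G] [TopologicalSpace G] {X : Type u} [MeasurableSpace X]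
    (μ : Measure X) : Type (max u v) := G →ₜ* aut μ

variable {μ : Measure X}

/-- The translate `g a`. -/
noncomputable def BooleanAction.act (β : BooleanAction G μ) (g : G) (a : MeasureAlgebra μ) : MeasureAlgebra μ :=
  (β g).1 a

/-- `f` is `G`-continuous: `f ∘ g_n → f` in `L^∞` whenever `g_n → e`. -/
def BooleanAction.GContinuous (β : BooleanAction G μ) (f : Lp ℝ ∞ μ) : Prop :=
  ∀ g : ℕ → G, Tendsto g atTop (𝓝 1) →
    ∃ h : ℕ → Lp ℝ ∞ μ, (∀ n, IsComp f (β (g n)) (h n)) ∧ Tendsto h atTop (𝓝 f)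

/-- The sub-σ-algebra generated by the `G`-continuous functions. -/
def BooleanAction.gContinuousAlgebra (β : BooleanAction G μ) : Set (MeasureAlgebra μ) :=
  sigmaGenerated {a | ∃ f : Lp ℝ ∞ μ, β.GContinuous f ∧
    ∃ (B : Set ℝ) (hB : MeasurableSet B), a = level f B hB}

/-- `U a = ⋃ {γ a : γ ∈ U'}`, where `U'` is a countable dense subset of `U`. -/
noncomputable def BooleanAction.sweep [PolishSpace G] (β : BooleanAction G μ) (U : Set G)
    (a : MeasureAlgebra μ) : MeasureAlgebra μ :=
  union fun γ : denseSubset U => β.act γ a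

/-- A sequence of symmetric neighbourhoods of the identity with `U_{m+1}² ⊆ U_m` that forms a
neighbourhood basis (so that, in a Hausdorff group, its intersection is `{e}`). -/
structure IsSymmetricBasis (U : ℕ → Set G) : Prop where
  mem_nhds : ∀ m, U m ∈ 𝓝 (1 : G)
  mul_subset : ∀ m, U (m + 1) * U (m + 1) ⊆ U m
  inv_eq : ∀ m, (U m)⁻¹ = U m
  basis : ∀ V ∈ 𝓝 (1 : G), ∃ m, U m ⊆ V

/-- `ã = ⋂ m, U_m a`. -/
noncomputable def BooleanAction.tilde [PolishSpace G] (β : BooleanAction G μ) (U : ℕ → Set G)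
    (a : MeasureAlgebra μ) : MeasureAlgebra μ :=
  inter fun m : ℕ => β.sweep (U m) a

/-- Stable elements of the measure algebra. -/
def BooleanAction.Stable [PolishSpace G] (β : BooleanAction G μ) (U : ℕ → Set G)
    (a : MeasureAlgebra μ) : Prop :=
  a = ⊥ ∨ β.tilde U a = a

/-- The sub-σ-algebra generated by the stable elements. -/
def BooleanAction.stableAlgebra [PolishSpace G] (β : BooleanAction G μ) (U : ℕ → Set G) :
    Set (MeasureAlgebra μ) :=
  sigmaGenerated {a | β.Stable U a}

end Action

section Spatial

open MeasureAlgebra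

/-- A spatial action of `G` on a standard Borel probability space: a Borel action each of whose
elements preserves the measure. -/
structure SpatialAction (G : Type v) [Group G] [MeasurableSpace G] {Y : Type w}
    [MeasurableSpace Y] (ν : Measure Y) extends MulAction G Y where
  measurable_act : Measurable fun p : G × Y => p.1 • p.2
  preserves : ∀ g : G, MeasurePreserving (fun y : Y => g • y) ν ν

variable {G : Type v} [Group G] [MeasurableSpace G] {Y : Type w} [MeasurableSpace Y]
  {ν : Measure Y}

/-- The action on the measure algebra induced by a spatial action. The image `g s` is written
as the preimage of `s` under `g⁻¹`. -/
def SpatialAction.act (σ : SpatialAction G ν) (g : G) : MeasureAlgebra ν → MeasureAlgebra ν :=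
  Quotient.map
    (fun s => ⟨(fun y : Y => σ.smul g⁻¹ y) ⁻¹' s, (σ.preserves g⁻¹).measurable s.2⟩)
    (fun _ _ h => (σ.preserves g⁻¹).quasiMeasurePreserving.ae_eq_comp h)

/-- A boolean action admits a spatial model if it is isomorphic, as a boolean action, to the one
induced by a spatial action on some standard Borel probability space. -/
def BooleanAction.AdmitsSpatialModel [TopologicalSpace G] {X : Type u} [MeasurableSpace X]
    {μ : Measure X} (β : BooleanAction G μ) : Prop :=
  ∃ (Y : Type u) (_ : MeasurableSpace Y) (_ : StandardBorelSpace Y) (ν : Measure Y)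
    (_ : IsProbabilityMeasure ν) (σ : SpatialAction G ν)
    (φ : MeasureAlgebra μ ≃o MeasureAlgebra ν),
    (∀ a, (φ a).meas = a.meas) ∧ ∀ (g : G) (a : MeasureAlgebra μ), φ (β.act g a) = σ.act g (φ a)

end Spatial

end BooleanSystem

/-!
Fix a length function `N ≤ 1` on `G` whose balls form a basis at the identity (`exists_isLength`).
For an element `a` of the measure algebra and `g ∈ G`, let `F_g(x) = inf {N (g γ) : x ∈ γ a}`, the
infimum being over a countable dense set of `γ` (`orbitFun`). Three properties carry the proof:
`g ↦ F_g(x)` is Lipschitz for the distance `N (g h⁻¹)` at *every* point `x`; `F_1 ∘ g = F_g` in the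
measure algebra; and `{F_1 < r}` is the sweep of `a` by the ball of radius `r`. So `F_1` is
`G`-continuous, every sweep of an element by a ball lies in the algebra of `G`-continuous functions,
and `{F_1 ≤ 0} = ã`.

*The two algebras coincide.* A stable `a` is `{F_1 ≤ 0}`. Conversely the set `{t ≤ f}` is stable
when `f` is `G`-continuous, because small translates of it are contained in `{t - ε ≤ f}`.

*Generation by stable elements gives a spatial model.* Countably many stable elements generate. The
map `x ↦ (g ↦ F_g(x))`, formed for each of them, takes values in a countable power of the space of
Lipschitz functions on `G`, which is a standard Borel space on which `G` acts by right translations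
(`ModelSpace`). The image of `μ` is the required model; no null sets have to be discarded, as
the Lipschitz property holds everywhere.

*A spatial model gives generation by stable elements.* The Vaught transforms
`A^{ΔU} = {y : g y ∈ A for nonmeagrely many g ∈ U}`, with `A` in a countable generating family and
`U` a basic open set, are Borel and separate points, hence generate the Borel sets. Since
`h A^{ΔV} = A^{ΔVh⁻¹}`, the set `A^{ΔU}` is the union of the sweeps of `A^{ΔV}` by a ball `B`, over
all basic `V` and balls `B` with `V B⁻¹ ⊆ U`, and sweeps by balls lie in the algebra of
`G`-continuous functions.
-/

namespace BooleanSystem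

/-! ### Length functions on Polish groups -/

theorem abs_sub_map_le {G : Type v} [Group G] (N : GroupSeminorm G) (g h : G) :
    |N g - N h| ≤ N (g * h⁻¹) := by
  rw [abs_sub_le_iff]
  constructor
  · have := map_mul_le_add N (g * h⁻¹) h
    rw [inv_mul_cancel_right] at this
    linarith
  · have := map_mul_le_add N (h * g⁻¹) g
    rw [inv_mul_cancel_right, ← map_inv_eq_map N (h * g⁻¹), mul_inv_rev, inv_inv] at this
    linarith

/-- A length function bounded by `1` whose balls form a neighbourhood basis of the identity. The
distance `(g, h) ↦ N (g * h⁻¹)` is then a right-invariant metric for the topology. -/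
structure IsLength {G : Type v} [Group G] [TopologicalSpace G] (N : GroupSeminorm G) : Prop where
  le_one : ∀ g, N g ≤ 1
  hasBasis : (𝓝 (1 : G)).HasBasis (fun r : ℝ => 0 < r) fun r => {g | N g < r}

/-- Existence of length functions. The right uniform structure is pseudometrizable, by `d` say, and
`sup_h min 1 (d (g h) h)` does the job: the supremum makes the distance right-invariant, and since
the right uniform structure is invariant under right translations, the neighbourhoods of `1` are
unchanged. -/
theorem exists_isLength (G : Type v) [Group G] [TopologicalSpace G] [IsTopologicalGroup G]
    [FirstCountableTopology G] : ∃ N : GroupSeminorm G, IsLength N := by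
  let u : UniformSpace G := IsTopologicalGroup.rightUniformSpace G
  have hu : uniformity G = comap (fun x : G × G => x.2 * x.1⁻¹) (𝓝 1) := rfl
  have : (uniformity G).IsCountablyGenerated := by rw [hu]; infer_instance
  let I : PseudoMetricSpace G := UniformSpace.pseudoMetricSpace G
  have hbdd : ∀ g : G, BddAbove (range fun h : G => min 1 (dist (g * h) h)) := fun g =>
    ⟨1, by rintro _ ⟨h, rfl⟩; exact min_le_left _ _⟩
  have hle : ∀ g h : G, min 1 (dist (g * h) h) ≤ ⨆ h : G, min 1 (dist (g * h) h) := fun g h =>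
    le_ciSup (hbdd g) h
  let N : GroupSeminorm G :=
    { toFun := fun g => ⨆ h : G, min 1 (dist (g * h) h)
      map_one' := by simp
      mul_le' := fun g k => by
        refine ciSup_le fun h => ?_
        have h1 := hle g (k * h)
        have h2 := hle k h
        have h3 := dist_triangle (g * k * h) (k * h) h
        rw [← mul_assoc] at h1
        have h4 : min 1 (dist (g * k * h) h)
            ≤ min 1 (dist (g * k * h) (k * h)) + min 1 (dist (k * h) h) := by
          have := dist_nonneg (x := g * k * h) (y := k * h)
          have := dist_nonneg (x := k * h) (y := h)
          rcases le_total 1 (dist (g * k * h) (k * h)) with a | a <;>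
          rcases le_total 1 (dist (k * h) h) with b | b <;>
          simp only [a, b, min_eq_left, min_eq_right] <;>
          first
            | exact (min_le_left _ _).trans (by linarith)
            | exact (min_le_right _ _).trans (by linarith)
        linarith
      inv' := fun g => by
        refine le_antisymm (ciSup_le fun h => ?_) (ciSup_le fun h => ?_)
        · have := hle g (g⁻¹ * h)
          rwa [mul_inv_cancel_left, dist_comm] at this
        · have := hle g⁻¹ (g * h)
          rwa [inv_mul_cancel_left, dist_comm] at this }
  have hN : ∀ g, N g = ⨆ h : G, min 1 (dist (g * h) h) := fun g => rfl
  refine ⟨N, fun g => ciSup_le fun h => min_le_left _ _, ⟨fun V => ⟨fun hV => ?_, ?_⟩⟩⟩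
  · obtain ⟨r, hr, hrV⟩ := Metric.mem_nhds_iff.1 hV
    refine ⟨min r 1, by positivity, fun g hg => hrV ?_⟩
    have h1 := (hle g 1).trans_lt hg
    rw [mul_one] at h1
    rcases min_lt_iff.1 h1 with h2 | h2
    · exact absurd h2 (not_lt.2 (min_le_right _ _))
    · exact h2.trans_le (min_le_left _ _)
  · rintro ⟨r, hr, hrV⟩
    refine mem_of_superset ?_ hrV
    have h1 : {p : G × G | dist p.1 p.2 < r / 2} ∈ uniformity G :=
      Metric.dist_mem_uniformity (half_pos hr)
    rw [hu] at h1
    obtain ⟨W, hW, hWr⟩ := h1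
    filter_upwards [hW] with g hg
    refine lt_of_le_of_lt (ciSup_le fun h => (min_le_right _ _).trans ?_) (half_lt_self hr)
    have h2 : (h, g * h) ∈ {p : G × G | dist p.1 p.2 < r / 2} := hWr (by simpa using hg)
    rw [dist_comm]
    exact le_of_lt h2

namespace IsLength

variable {G : Type v} [Group G] [TopologicalSpace G] {N : GroupSeminorm G}

theorem ball_mem (hN : IsLength N) {r : ℝ} (hr : 0 < r) : {g | N g < r} ∈ 𝓝 (1 : G) :=
  hN.hasBasis.mem_of_mem hr

theorem mem_nhds [IsTopologicalGroup G] (hN : IsLength N) (g : G) {r : ℝ} (hr : 0 < r) :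
    {h | N (h * g⁻¹) < r} ∈ 𝓝 g := by
  have : Tendsto (fun h => h * g⁻¹) (𝓝 g) (𝓝 1) := by
    have h1 : Continuous fun h : G => h * g⁻¹ := by fun_prop
    simpa using h1.tendsto g
  exact this (hN.ball_mem hr)

theorem continuous_of_abs_sub_le [IsTopologicalGroup G] (hN : IsLength N) {φ : G → ℝ}
    (h : ∀ g k, |φ g - φ k| ≤ N (g * k⁻¹)) : Continuous φ := by
  refine continuous_iff_continuousAt.2 fun k => Metric.tendsto_nhds.2 fun ε hε => ?_
  filter_upwards [hN.mem_nhds k hε] with g hg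
  exact (h g k).trans_lt hg

theorem continuous [IsTopologicalGroup G] (hN : IsLength N) : Continuous N :=
  hN.continuous_of_abs_sub_le (abs_sub_map_le N)

end IsLength

/-! ### The measure algebra -/

namespace MeasureAlgebra

variable {X : Type u} [MeasurableSpace X] {μ : Measure X}

theorem mk_iUnion {ι : Type*} [Countable ι] {s : ι → Set X} (hs : ∀ i, MeasurableSet (s i)) :
    mk μ (⋃ i, s i) (MeasurableSet.iUnion hs) = union fun i => mk μ (s i) (hs i) := by
  refine mk_eq_mk.2 (Filter.EventuallyEq.countable_iUnion fun i => ?_)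
  exact (mk_eq_mk (hs := (mk μ (s i) (hs i)).measurableSet_rep) (ht := hs i)).1
    (mk_rep _) |>.symm

theorem isLUB_mk_iUnion {ι : Type*} [Countable ι] {s : ι → Set X}
    (hs : ∀ i, MeasurableSet (s i)) :
    IsLUB (range fun i => mk μ (s i) (hs i)) (mk μ (⋃ i, s i) (MeasurableSet.iUnion hs)) := by
  rw [mk_iUnion]
  exact isLUB_union _

theorem mk_iInter {ι : Type*} [Countable ι] {s : ι → Set X} (hs : ∀ i, MeasurableSet (s i)) :
    mk μ (⋂ i, s i) (MeasurableSet.iInter hs) = inter fun i => mk μ (s i) (hs i) := by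
  refine mk_eq_mk.2 (Filter.EventuallyEq.countable_iInter fun i => ?_)
  exact (mk_eq_mk (hs := (mk μ (s i) (hs i)).measurableSet_rep) (ht := hs i)).1
    (mk_rep _) |>.symm

theorem orderIso_union {Y : Type w} [MeasurableSpace Y] {ν : Measure Y} {ι : Type*} [Countable ι]
    (T : MeasureAlgebra μ ≃o MeasureAlgebra ν) (a : ι → MeasureAlgebra μ) :
    T (union a) = union fun i => T (a i) := by
  refine IsLUB.unique ?_ (isLUB_union _)
  have := (T.isLUB_image' (s := range a) (x := union a)).2 (isLUB_union a)
  rwa [← range_comp] at this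

theorem mk_le_of_subset {s t : Set X} {hs : MeasurableSet s} {ht : MeasurableSet t} (h : s ⊆ t) :
    mk μ s hs ≤ mk μ t ht :=
  mk_le_mk.2 (LE.le.eventuallyLE h)

theorem mk_empty : mk μ ∅ MeasurableSet.empty = ⊥ := rfl

theorem meas_mk {s : Set X} (hs : MeasurableSet s) : (mk μ s hs).meas = μ s := rfl

theorem meas_mono {a b : MeasureAlgebra μ} (h : a ≤ b) : a.meas ≤ b.meas := by
  induction a using ind; induction b using ind
  exact measure_mono_ae h

theorem meas_eq_zero {a : MeasureAlgebra μ} : a.meas = 0 ↔ a = ⊥ := by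
  induction a using ind with
  | h s hs => rw [← mk_empty, mk_eq_mk]; exact ae_eq_empty.symm

/-- An automorphism carrying the preimages under `f` of a generating family of sets to their
preimages under `f'` does so for all measurable sets. -/
theorem map_mk_preimage {Z : Type w} [mZ : MeasurableSpace Z]
    (T : MeasureAlgebra μ ≃o MeasureAlgebra μ)
    {f f' : X → Z} (hf : Measurable f) (hf' : Measurable f') {C : Set (Set Z)}
    (hC : mZ = MeasurableSpace.generateFrom C)
    (h : ∀ s ∈ C, ∀ hs : MeasurableSet s, T (mk μ (f ⁻¹' s) (hf hs)) = mk μ (f' ⁻¹' s) (hf' hs))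
    {s : Set Z} (hs : MeasurableSet s) :
    T (mk μ (f ⁻¹' s) (hf hs)) = mk μ (f' ⁻¹' s) (hf' hs) := by
  subst hC
  induction s, hs using MeasurableSpace.generateFrom_induction with
  | hC s hs hs' => exact h s hs hs'
  | empty => exact T.map_bot
  | compl s hs ih =>
    have := congrArg compl ih
    rwa [← map_compl'] at this
  | iUnion s hs ih =>
    have h1 := mk_iUnion (μ := μ) fun i => hf (hs i)
    have h2 := mk_iUnion (μ := μ) fun i => hf' (hs i)
    simp only [preimage_iUnion]
    rw [h1, h2, orderIso_union]
    exact congrArg union (funext ih)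

theorem isSigmaSubalgebra_sigmaGenerated (C : Set (MeasureAlgebra μ)) :
    IsSigmaSubalgebra (sigmaGenerated C) where
  bot_mem _ hS _ := hS.bot_mem
  compl_mem a ha S hS hC := hS.compl_mem a (ha S hS hC)
  union_mem a ha S hS hC := hS.union_mem a fun n => ha n S hS hC

theorem subset_sigmaGenerated (C : Set (MeasureAlgebra μ)) : C ⊆ sigmaGenerated C :=
  fun _ ha _ _ hC => hC ha

theorem sigmaGenerated_subset {C S : Set (MeasureAlgebra μ)} (hS : IsSigmaSubalgebra S)
    (h : C ⊆ S) : sigmaGenerated C ⊆ S := fun _ ha => ha S hS h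

theorem sigmaGenerated_mono {C D : Set (MeasureAlgebra μ)} (h : C ⊆ D) :
    sigmaGenerated C ⊆ sigmaGenerated D :=
  sigmaGenerated_subset (isSigmaSubalgebra_sigmaGenerated D) (h.trans (subset_sigmaGenerated D))

theorem IsSigmaSubalgebra.union_mem' {S : Set (MeasureAlgebra μ)} (hS : IsSigmaSubalgebra S)
    {ι : Type*} [Countable ι] (a : ι → MeasureAlgebra μ) (ha : ∀ i, a i ∈ S) : union a ∈ S := by
  rcases isEmpty_or_nonempty ι with hι | hι
  · have : union a = ⊥ := by
      refine (isLUB_union a).unique ?_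
      rw [range_eq_empty]
      exact isLUB_empty
    rw [this]
    exact hS.bot_mem
  · obtain ⟨e, he⟩ := exists_surjective_nat ι
    have : union a = union fun n => a (e n) := by
      refine (isLUB_union a).unique ?_
      have h := isLUB_union fun n => a (e n)
      rwa [show (fun n => a (e n)) = a ∘ e from rfl, he.range_comp] at h
    rw [this]
    exact hS.union_mem _ fun n => ha _

/-- The classes of the preimages of measurable sets belong to a sub-σ-algebra as soon as those of a
generating family do. -/
theorem IsSigmaSubalgebra.mk_preimage_mem {S : Set (MeasureAlgebra μ)} (hS : IsSigmaSubalgebra S)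
    {Z : Type w} [mZ : MeasurableSpace Z] {f : X → Z} (hf : Measurable f) {C : Set (Set Z)}
    (hC : mZ = MeasurableSpace.generateFrom C)
    (h : ∀ s ∈ C, ∀ hs : MeasurableSet s, MeasureAlgebra.mk μ (f ⁻¹' s) (hf hs) ∈ S)
    {s : Set Z} (hs : MeasurableSet s) : MeasureAlgebra.mk μ (f ⁻¹' s) (hf hs) ∈ S := by
  subst hC
  induction s, hs using MeasurableSpace.generateFrom_induction with
  | hC s hs hs' => exact h s hs hs'
  | empty => exact hS.bot_mem
  | compl s hs ih => exact hS.compl_mem _ ih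
  | iUnion s hs ih =>
    have h1 := mk_iUnion (μ := μ) fun i => hf (hs i)
    simp only [preimage_iUnion]
    rw [h1]
    exact hS.union_mem _ ih

theorem exists_countable_mem_sigmaGenerated {C : Set (MeasureAlgebra μ)} {a : MeasureAlgebra μ}
    (ha : a ∈ sigmaGenerated C) : ∃ D ⊆ C, D.Countable ∧ a ∈ sigmaGenerated D := by
  refine ha {a | ∃ D ⊆ C, D.Countable ∧ a ∈ sigmaGenerated D} ⟨?_, ?_, ?_⟩ ?_
  · exact ⟨∅, empty_subset _, countable_empty, (isSigmaSubalgebra_sigmaGenerated _).bot_mem⟩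
  · rintro a ⟨D, hD, hc, h⟩
    exact ⟨D, hD, hc, (isSigmaSubalgebra_sigmaGenerated _).compl_mem a h⟩
  · intro a h
    choose D hD hc h using h
    exact ⟨⋃ n, D n, iUnion_subset hD, countable_iUnion hc,
      (isSigmaSubalgebra_sigmaGenerated _).union_mem a fun n =>
        sigmaGenerated_mono (subset_iUnion D n) (h n)⟩
  · exact fun a ha => ⟨{a}, singleton_subset_iff.2 ha, countable_singleton a,
      subset_sigmaGenerated _ rfl⟩

/-- The measure algebra of a countably generated measurable space is generated by countably many
elements, so a family generating it has a countable subfamily that does. -/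
theorem exists_countable_sigmaGenerated_eq_univ [MeasurableSpace.CountablyGenerated X]
    {C : Set (MeasureAlgebra μ)} (hC : sigmaGenerated C = univ) :
    ∃ D ⊆ C, D.Countable ∧ sigmaGenerated D = univ := by
  have hm : ∀ a : MeasureAlgebra μ, a ∈ sigmaGenerated C := fun a => hC ▸ mem_univ a
  choose D hD hc h using fun a => exists_countable_mem_sigmaGenerated (hm a)
  let K := MeasurableSpace.countableGeneratingSet X
  have hK : K.Countable := MeasurableSpace.countable_countableGeneratingSet
  have := hK.to_subtype
  let κ : K → MeasureAlgebra μ := fun s =>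
    mk μ s.1 (MeasurableSpace.measurableSet_countableGeneratingSet s.2)
  refine ⟨⋃ s : K, D (κ s), iUnion_subset fun s => hD _, countable_iUnion fun s => hc _, ?_⟩
  refine eq_univ_of_forall fun a => ?_
  rw [← a.mk_rep]
  refine (isSigmaSubalgebra_sigmaGenerated _).mk_preimage_mem (f := id) measurable_id
    MeasurableSpace.generateFrom_countableGeneratingSet.symm (fun s hs _ => ?_) a.measurableSet_rep
  exact sigmaGenerated_mono (subset_iUnion (fun s : K => D (κ s)) ⟨s, hs⟩) (h (κ ⟨s, hs⟩))

end MeasureAlgebra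

section

open MeasureAlgebra

variable {G : Type v} [Group G] [TopologicalSpace G] {X : Type u} [MeasurableSpace X]
  {μ : Measure X}

/-! ### Boolean actions and sweeps -/

namespace BooleanAction

variable (β : BooleanAction G μ)

theorem act_mul (g h : G) (a : MeasureAlgebra μ) : β.act (g * h) a = β.act g (β.act h a) := by
  simp only [act, map_mul]
  rfl

theorem act_one (a : MeasureAlgebra μ) : β.act 1 a = a := by
  simp only [act, map_one]
  rfl

theorem act_inv_act (g : G) (a : MeasureAlgebra μ) : β.act g⁻¹ (β.act g a) = a := by
  rw [← act_mul, inv_mul_cancel, act_one]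

theorem act_act_inv (g : G) (a : MeasureAlgebra μ) : β.act g (β.act g⁻¹ a) = a := by
  rw [← act_mul, mul_inv_cancel, act_one]

theorem act_le_act {g : G} {a b : MeasureAlgebra μ} : β.act g a ≤ β.act g b ↔ a ≤ b :=
  (β g).1.le_iff_le

theorem act_le_iff {g : G} {a b : MeasureAlgebra μ} : β.act g a ≤ b ↔ a ≤ β.act g⁻¹ b := by
  rw [← act_le_act β (g := g⁻¹), act_inv_act]

/-- Upper bounds of orbit pieces are not affected by closure, since `g ↦ g a` is continuous in
measure. -/
theorem act_le_of_mem_closure {D : Set G} {γ : G} (hγ : γ ∈ closure D) {a b : MeasureAlgebra μ}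
    (h : ∀ δ ∈ D, β.act δ a ≤ b) : β.act γ a ≤ b := by
  rw [← sdiff_eq_bot_iff, ← meas_eq_zero]
  refine le_antisymm (le_of_forall_pos_le_add fun ε hε => ?_) bot_le
  have hO : IsOpen {T : aut μ | meas ((β γ).1 a ∆ T.1 a) < ε} :=
    TopologicalSpace.isOpen_generateFrom_of_mem ⟨β γ, a, ε, hε, rfl⟩
  obtain ⟨δ, hδ, hδD⟩ := mem_closure_iff.1 hγ _ (hO.preimage (map_continuous β))
    (by simpa [symmDiff_self, meas_eq_zero.2 rfl] using hε)
  have h1 : β.act γ a \ b ≤ β.act γ a ∆ β.act δ a :=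
    (sdiff_le_sdiff_left (h δ hδD)).trans le_sup_left
  rw [zero_add]
  exact (meas_mono h1).trans (le_of_lt hδ)

variable [PolishSpace G]

/-- The sweep is the supremum over all translates, countable or not; in particular it does not
depend on the choice of the countable dense subset. -/
theorem isLUB_sweep (U : Set G) (a : MeasureAlgebra μ) :
    IsLUB ((fun g => β.act g a) '' U) (β.sweep U a) := by
  have h := isLUB_union fun γ : denseSubset U => β.act γ a
  refine ⟨?_, fun b hb => h.2 ?_⟩
  · rintro _ ⟨g, hg, rfl⟩
    exact act_le_of_mem_closure β ((denseSubset_spec U).2.2 hg) fun δ hδ => h.1 ⟨⟨δ, hδ⟩, rfl⟩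
  · rintro _ ⟨γ, rfl⟩
    exact hb ⟨γ, (denseSubset_spec U).1 γ.2, rfl⟩

theorem act_le_sweep {U : Set G} {g : G} (hg : g ∈ U) (a : MeasureAlgebra μ) :
    β.act g a ≤ β.sweep U a :=
  (β.isLUB_sweep U a).1 ⟨g, hg, rfl⟩

theorem sweep_le {U : Set G} {a b : MeasureAlgebra μ} (h : ∀ g ∈ U, β.act g a ≤ b) :
    β.sweep U a ≤ b :=
  (β.isLUB_sweep U a).2 (by rintro _ ⟨g, hg, rfl⟩; exact h g hg)

theorem sweep_mono {U V : Set G} (h : U ⊆ V) (a : MeasureAlgebra μ) :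
    β.sweep U a ≤ β.sweep V a :=
  β.sweep_le fun _ hg => β.act_le_sweep (h hg) a

theorem le_sweep {U : Set G} (hU : (1 : G) ∈ U) (a : MeasureAlgebra μ) : a ≤ β.sweep U a := by
  simpa [act_one] using β.act_le_sweep hU a

theorem act_sweep (k : G) (U : Set G) (a : MeasureAlgebra μ) :
    β.act k (β.sweep U a) = β.sweep {γ | k⁻¹ * γ ∈ U} a := by
  apply le_antisymm
  · rw [act_le_iff]
    refine β.sweep_le fun g hg => ?_
    rw [← act_le_act β (g := k), act_act_inv, ← act_mul]
    exact β.act_le_sweep (by simpa using hg) a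
  · refine β.sweep_le fun g hg => ?_
    have := β.act_le_sweep (show k⁻¹ * g ∈ U from hg) a
    rwa [act_mul, act_le_iff, inv_inv] at this

end BooleanAction

/-! ### Orbit functions -/

instance [PolishSpace G] : Nonempty (denseSubset (univ : Set G)) := by
  by_contra h
  have h1 : denseSubset (univ : Set G) = ∅ :=
    eq_empty_iff_forall_notMem.2 fun x hx => h ⟨⟨x, hx⟩⟩
  have := (denseSubset_spec (univ : Set G)).2.2 (mem_univ 1)
  rw [h1, closure_empty] at this
  exact this

namespace BooleanAction

variable (β : BooleanAction G μ) [PolishSpace G] (N : GroupSeminorm G)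

open Classical in
/-- The function `x ↦ inf {N (g γ) : x ∈ γ a}`, with value `1` outside all translates of `a`. The
infimum is over a countable dense set of `γ`. For `g = 1` it measures how far `x` has to be moved to
enter `a`, and composing it with `g` gives, almost everywhere, the function for `g`. -/
noncomputable def orbitFun (a : MeasureAlgebra μ) (g : G) (x : X) : ℝ :=
  ⨅ γ : denseSubset (univ : Set G), if x ∈ (β.act γ a).rep then N (g * γ) else 1

variable {N}

theorem bddBelow_orbitFun (a : MeasureAlgebra μ) (g : G) (x : X) [∀ p, Decidable p] :
    BddBelow (range fun γ : denseSubset (univ : Set G) =>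
      if x ∈ (β.act γ a).rep then N (g * γ) else 1) :=
  ⟨0, by rintro _ ⟨γ, rfl⟩; dsimp only; split_ifs; exacts [apply_nonneg N _, zero_le_one]⟩

theorem measurable_orbitFun (a : MeasureAlgebra μ) (g : G) : Measurable (β.orbitFun N a g) := by
  classical
  exact Measurable.iInf fun γ =>
    Measurable.ite (β.act γ a).measurableSet_rep measurable_const measurable_const

theorem orbitFun_lt_iff (a : MeasureAlgebra μ) (g : G) (x : X) {r : ℝ} (hr : r ≤ 1) :
    β.orbitFun N a g x < r ↔
      ∃ γ : denseSubset (univ : Set G), N (g * γ) < r ∧ x ∈ (β.act γ a).rep := by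
  classical
  rw [orbitFun, ciInf_lt_iff (β.bddBelow_orbitFun a g x)]
  refine exists_congr fun γ => ?_
  split_ifs with h <;> simp [h, hr]

theorem orbitFun_nonneg (a : MeasureAlgebra μ) (g : G) (x : X) : 0 ≤ β.orbitFun N a g x := by
  classical
  refine le_ciInf fun γ => ?_
  split_ifs
  exacts [apply_nonneg N _, zero_le_one]

theorem orbitFun_le_one (hN : IsLength N) (a : MeasureAlgebra μ) (g : G) (x : X) :
    β.orbitFun N a g x ≤ 1 := by
  classical
  obtain ⟨γ⟩ := (inferInstance : Nonempty (denseSubset (univ : Set G)))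
  refine (ciInf_le (β.bddBelow_orbitFun a g x) γ).trans ?_
  split_ifs
  exacts [hN.le_one _, le_rfl]

/-- For every point `x`, the function `g ↦ orbitFun a g x` is Lipschitz for the right-invariant
distance. This holds everywhere, with no exceptional null set. -/
theorem abs_orbitFun_sub_le (a : MeasureAlgebra μ) (g h : G) (x : X) :
    |β.orbitFun N a g x - β.orbitFun N a h x| ≤ N (g * h⁻¹) := by
  classical
  have key : ∀ g h : G, β.orbitFun N a g x ≤ β.orbitFun N a h x + N (g * h⁻¹) := fun g h => by
    rw [← sub_le_iff_le_add]
    refine le_ciInf fun γ => ?_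
    rw [sub_le_iff_le_add]
    refine (ciInf_le (β.bddBelow_orbitFun a g x) γ).trans ?_
    split_ifs
    · have := map_mul_le_add N (g * h⁻¹) (h * γ)
      rw [mul_assoc, inv_mul_cancel_left] at this
      linarith
    · linarith [apply_nonneg N (g * h⁻¹)]
  have h1 := key g h
  have h2 := key h g
  rw [← map_inv_eq_map N (h * g⁻¹), mul_inv_rev, inv_inv] at h2
  rw [abs_sub_le_iff]
  constructor <;> linarith

variable [IsTopologicalGroup G]

theorem mk_orbitFun_lt (hN : IsLength N) (a : MeasureAlgebra μ) (g : G) {r : ℝ} (hr : r ≤ 1) :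
    mk μ (β.orbitFun N a g ⁻¹' Iio r) (β.measurable_orbitFun a g measurableSet_Iio) =
      β.sweep {γ | N (g * γ) < r} a := by
  have h1 : β.orbitFun N a g ⁻¹' Iio r =
      ⋃ γ : {γ : denseSubset (univ : Set G) // N (g * γ) < r}, (β.act γ a).rep := by
    ext x
    simp [orbitFun_lt_iff, hr]
  have h2 := isLUB_mk_iUnion (μ := μ)
    (s := fun γ : {γ : denseSubset (univ : Set G) // N (g * γ) < r} => (β.act γ a).rep)
    fun γ => measurableSet_rep _
  simp only [mk_rep] at h2
  simp only [h1]
  refine le_antisymm (h2.2 ?_) (β.sweep_le fun k hk => ?_)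
  · rintro _ ⟨γ, rfl⟩
    exact β.act_le_sweep γ.2 a
  · have hO : IsOpen {γ | N (g * γ) < r} :=
      isOpen_lt (hN.continuous.comp (continuous_const_mul g)) continuous_const
    have hk' : k ∈ closure ({γ | N (g * γ) < r} ∩ denseSubset univ) :=
      hO.inter_closure ⟨hk, (denseSubset_spec univ).2.2 (mem_univ k)⟩
    exact β.act_le_of_mem_closure hk' fun δ hδ => h2.1 ⟨⟨⟨δ, hδ.2⟩, hδ.1⟩, rfl⟩

/-- Composing an orbit function with `k` amounts to translating its parameter by `k`. -/
theorem act_mk_orbitFun (hN : IsLength N) (a : MeasureAlgebra μ) (g k : G) {B : Set ℝ}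
    (hB : MeasurableSet B) :
    β.act k⁻¹ (mk μ (β.orbitFun N a g ⁻¹' B) (β.measurable_orbitFun a g hB)) =
      mk μ (β.orbitFun N a (g * k) ⁻¹' B) (β.measurable_orbitFun a (g * k) hB) := by
  refine map_mk_preimage (β k⁻¹).1 (β.measurable_orbitFun a g) (β.measurable_orbitFun a (g * k))
    ((BorelSpace.measurable_eq (α := ℝ)).trans (borel_eq_generateFrom_Iio ℝ)) ?_ hB
  rintro _ ⟨r, rfl⟩ -
  rcases le_or_gt r 1 with hr | hr
  · rw [β.mk_orbitFun_lt hN a g hr, β.mk_orbitFun_lt hN a (g * k) hr]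
    refine (β.act_sweep _ _ _).trans ?_
    simp only [inv_inv, mem_ofPred_eq, mul_assoc]
  · have h1 : ∀ g, β.orbitFun N a g ⁻¹' Iio r = univ := fun g =>
      eq_univ_of_forall fun x => (β.orbitFun_le_one hN a g x).trans_lt hr
    simp only [h1]
    exact (β k⁻¹).1.map_top

end BooleanAction

/-! ### The two sub-σ-algebras coincide -/

namespace MeasureAlgebra

/-- An element of `L^∞` is almost everywhere bounded by its norm. -/
theorem ae_norm_le_norm (f : Lp ℝ ∞ μ) : ∀ᵐ x ∂μ, ‖f x‖ ≤ ‖f‖ := by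
  filter_upwards [ae_le_eLpNormEssSup (f := f) (μ := μ)] with x hx
  rw [Lp.norm_def, ← toReal_enorm, eLpNorm_exponent_top]
  refine ENNReal.toReal_mono ?_ hx
  rw [← eLpNorm_exponent_top]
  exact Lp.eLpNorm_ne_top f

theorem level_toLp {f : X → ℝ} (hf : Measurable f) (h : MemLp f ∞ μ) {B : Set ℝ}
    (hB : MeasurableSet B) : level h.toLp B hB = mk μ (f ⁻¹' B) (hf hB) := by
  exact mk_eq_mk.2 (h.coeFn_toLp.preimage B)

end MeasureAlgebra

namespace BooleanAction

variable (β : BooleanAction G μ) [PolishSpace G] {N : GroupSeminorm G}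

theorem memLp_orbitFun (hN : IsLength N) (a : MeasureAlgebra μ) (g : G) :
    MemLp (β.orbitFun N a g) ∞ μ :=
  memLp_top_of_bound (β.measurable_orbitFun a g).aestronglyMeasurable 1 <|
    Eventually.of_forall fun x => by
      rw [Real.norm_of_nonneg (β.orbitFun_nonneg a g x)]
      exact β.orbitFun_le_one hN a g x

/-- The level sets `{t ≤ f}` of a `G`-continuous function are stable: a small translate of `{t ≤ f}`
is contained in `{t - ε ≤ f}`. -/
theorem stable_level_Ici {U : ℕ → Set G} (hU : IsSymmetricBasis U) {f : Lp ℝ ∞ μ}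
    (hf : β.GContinuous f) (t : ℝ) : β.Stable U (level f (Ici t) measurableSet_Ici) := by
  right
  set a := level f (Ici t) measurableSet_Ici
  -- Otherwise pick a bad `γ m` in each `U m`; this contradicts continuity along `(γ m)⁻¹ → 1`.
  have key : ∀ ε > 0, ∃ m, ∀ γ ∈ U m, β.act γ a ≤ level f (Ici (t - ε)) measurableSet_Ici := by
    intro ε hε
    by_contra! hcon
    choose γ hγ hcon using hcon
    have hγ1 : Tendsto (fun m => (γ m)⁻¹) atTop (𝓝 1) := by
      rw [tendsto_def]
      intro V hV
      obtain ⟨m, hm⟩ := hU.basis V hV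
      filter_upwards [eventually_ge_atTop m] with k hk
      have hanti : Antitone U := antitone_nat_of_succ_le fun n x hx =>
        hU.mul_subset n ⟨x, hx, 1, mem_of_mem_nhds (hU.mem_nhds _), mul_one x⟩
      refine hm (hanti hk ?_)
      rw [← hU.inv_eq]
      exact Set.inv_mem_inv.2 (hγ k)
    obtain ⟨h, hcomp, hh⟩ := hf _ hγ1
    rw [tendsto_iff_norm_sub_tendsto_zero] at hh
    obtain ⟨m, hm⟩ := (hh.eventually (gt_mem_nhds hε)).exists
    refine hcon m ?_
    have h1 := hcomp m (Ici t) measurableSet_Ici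
    rw [map_inv, inv_inv] at h1
    rw [show β.act (γ m) a = _ from h1.symm]
    refine mk_le_mk.2 ?_
    filter_upwards [Lp.coeFn_sub (h m) f, ae_norm_le_norm (h m - f)] with x hx hx' hxt
    rw [hx, Pi.sub_apply, Real.norm_eq_abs] at hx'
    have h2 := (le_abs_self _).trans (hx'.trans hm.le)
    have h3 : t ≤ h m x := hxt
    change t - ε ≤ f x
    linarith
  have h1 : (⇑f ⁻¹' Ici t : Set X) = ⋂ n : ℕ, ⇑f ⁻¹' Ici (t - 1 / (n + 1)) := by
    ext x
    simp only [mem_preimage, mem_Ici, mem_iInter]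
    refine ⟨fun h n => le_trans (by linarith [Nat.one_div_pos_of_nat (α := ℝ) (n := n)]) h,
      fun h => le_of_forall_pos_le_add fun ε hε => ?_⟩
    obtain ⟨n, hn⟩ := exists_nat_one_div_lt hε
    linarith [h n]
  apply le_antisymm
  · have h2 := mk_iInter (μ := μ) (s := fun n : ℕ => ⇑f ⁻¹' Ici (t - 1 / (n + 1)))
      fun n => (Lp.stronglyMeasurable f).measurable measurableSet_Ici
    have h3 : a = inter fun n : ℕ => level f (Ici (t - 1 / (n + 1))) measurableSet_Ici := by
      simp only [a, level, h1, h2]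
    rw [h3]
    refine (isGLB_inter _).2 ?_
    rintro _ ⟨n, rfl⟩
    obtain ⟨m, hm⟩ := key (1 / (n + 1)) (by positivity)
    rw [← h3]
    exact ((isGLB_inter _).1 ⟨m, rfl⟩).trans (β.sweep_le hm)
  · refine (isGLB_inter _).2 ?_
    rintro _ ⟨m, rfl⟩
    exact β.le_sweep (mem_of_mem_nhds (hU.mem_nhds m)) a

variable [IsTopologicalGroup G]

theorem gContinuous_orbitFun (hN : IsLength N) (a : MeasureAlgebra μ) :
    β.GContinuous (β.memLp_orbitFun hN a 1).toLp := by
  intro g hg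
  refine ⟨fun n => (β.memLp_orbitFun hN a (g n)).toLp, fun n B hB => ?_, ?_⟩
  · rw [level_toLp (β.measurable_orbitFun a _), level_toLp (β.measurable_orbitFun a _)]
    have := β.act_mk_orbitFun hN a 1 (g n) hB
    simp only [one_mul, act, map_inv] at this
    exact this.symm
  · rw [tendsto_iff_norm_sub_tendsto_zero]
    have h0 : Tendsto (fun n => N (g n)) atTop (𝓝 0) := by
      have := (hN.continuous.tendsto 1).comp hg
      rwa [map_one_eq_zero] at this
    refine squeeze_zero (fun n => norm_nonneg _) (fun n => ?_) h0
    rw [← MemLp.toLp_sub]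
    have hsub := (β.memLp_orbitFun hN a (g n)).sub (β.memLp_orbitFun hN a 1)
    rw [Lp.norm_def, eLpNorm_exponent_top]
    refine ENNReal.toReal_le_of_le_ofReal (apply_nonneg N _) (eLpNormEssSup_le_of_ae_bound ?_)
    filter_upwards [hsub.coeFn_toLp] with x hx
    rw [hx, Pi.sub_apply, Real.norm_eq_abs]
    simpa using β.abs_orbitFun_sub_le (N := N) a (g n) 1 x

theorem mk_orbitFun_mem (hN : IsLength N) (a : MeasureAlgebra μ) {B : Set ℝ}
    (hB : MeasurableSet B) :
    mk μ (β.orbitFun N a 1 ⁻¹' B) (β.measurable_orbitFun a 1 hB) ∈ β.gContinuousAlgebra :=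
  subset_sigmaGenerated _ ⟨_, β.gContinuous_orbitFun hN a, B, hB,
    (level_toLp (β.measurable_orbitFun a 1) _ hB).symm⟩

/-- Sweeping an arbitrary element by a ball gives a level set of an orbit function. -/
theorem sweep_ball_mem (hN : IsLength N) (a : MeasureAlgebra μ) {r : ℝ} (hr : r ≤ 1) :
    β.sweep {γ | N γ < r} a ∈ β.gContinuousAlgebra := by
  have := β.mk_orbitFun_mem hN a (measurableSet_Iio (a := r))
  rw [β.mk_orbitFun_lt hN a 1 hr] at this
  simpa only [one_mul] using this

theorem tilde_eq_mk (hN : IsLength N) {U : ℕ → Set G} (hU : IsSymmetricBasis U)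
    (a : MeasureAlgebra μ) :
    β.tilde U a =
      mk μ (β.orbitFun N a 1 ⁻¹' Iic 0) (β.measurable_orbitFun a 1 measurableSet_Iic) := by
  have hr : ∀ n : ℕ, (1 : ℝ) / (n + 1) ≤ 1 := fun n => by
    rw [div_le_one (by positivity)]
    exact le_add_of_nonneg_left n.cast_nonneg
  have h1 : β.orbitFun N a 1 ⁻¹' Iic 0 = ⋂ n : ℕ, β.orbitFun N a 1 ⁻¹' Iio (1 / (n + 1)) := by
    ext x
    simp only [mem_preimage, mem_Iic, mem_iInter, mem_Iio]
    refine ⟨fun h n => h.trans_lt (by positivity), fun h => le_of_forall_pos_lt_add fun ε hε => ?_⟩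
    obtain ⟨n, hn⟩ := exists_nat_one_div_lt hε
    rw [zero_add]
    exact (h n).trans hn
  have h2 := mk_iInter (μ := μ) (s := fun n : ℕ => β.orbitFun N a 1 ⁻¹' Iio (1 / (n + 1)))
    fun n => β.measurable_orbitFun a 1 measurableSet_Iio
  simp only [h1, h2]
  simp only [β.mk_orbitFun_lt hN a 1 (hr _), one_mul]
  apply le_antisymm
  · refine (isGLB_inter _).2 ?_
    rintro _ ⟨n, rfl⟩
    obtain ⟨m, hm⟩ := hU.basis _ (hN.ball_mem (r := 1 / ((n : ℝ) + 1)) (by positivity))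
    exact ((isGLB_inter _).1 ⟨m, rfl⟩).trans (β.sweep_mono hm a)
  · refine (isGLB_inter _).2 ?_
    rintro _ ⟨m, rfl⟩
    obtain ⟨r, hr, hrU⟩ := hN.hasBasis.mem_iff.1 (hU.mem_nhds m)
    obtain ⟨n, hn⟩ := exists_nat_one_div_lt hr
    exact ((isGLB_inter _).1 ⟨n, rfl⟩).trans
      (β.sweep_mono (fun γ hγ => hrU (lt_trans hγ hn)) a)

theorem gContinuousAlgebra_eq_stableAlgebra {U : ℕ → Set G} (hU : IsSymmetricBasis U) :
    β.gContinuousAlgebra = β.stableAlgebra U := by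
  apply Subset.antisymm
  · refine sigmaGenerated_subset (isSigmaSubalgebra_sigmaGenerated _) ?_
    rintro _ ⟨f, hf, B, hB, rfl⟩
    refine (isSigmaSubalgebra_sigmaGenerated _).mk_preimage_mem
      (Lp.stronglyMeasurable f).measurable
      ((BorelSpace.measurable_eq (α := ℝ)).trans (borel_eq_generateFrom_Ici ℝ)) ?_ hB
    rintro _ ⟨t, rfl⟩ -
    exact subset_sigmaGenerated _ (β.stable_level_Ici hU hf t)
  · obtain ⟨N, hN⟩ := exists_isLength G
    refine sigmaGenerated_subset (isSigmaSubalgebra_sigmaGenerated _) ?_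
    rintro a (rfl | ha)
    · exact (isSigmaSubalgebra_sigmaGenerated _).bot_mem
    · rw [← ha, β.tilde_eq_mk hN hU]
      exact β.mk_orbitFun_mem hN a measurableSet_Iic

end BooleanAction

end

section

open MeasureAlgebra

/-! ### A model space of Lipschitz functions -/

section ModelSpace

open TopologicalSpace

variable {G : Type v} [Group G] [TopologicalSpace G] [SeparableSpace G]

/-- Families of functions on `G`, indexed by `I`, that are Lipschitz with constant `1` for the
right-invariant distance defined by `N`. A function is recorded through its values on a dense
sequence, which puts the space in the universe of `I` and makes it a closed subset of a countable
product of lines. -/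
def ModelSpace (N : GroupSeminorm G) (I : Type u) : Type u :=
  {y : I × ℕ → ℝ // ∀ i n m, |y (i, n) - y (i, m)| ≤ N (denseSeq G n * (denseSeq G m)⁻¹)}

namespace ModelSpace

variable {N : GroupSeminorm G} {I : Type u}

instance : MeasurableSpace (ModelSpace N I) := Subtype.instMeasurableSpace

theorem measurable_coord (p : I × ℕ) : Measurable fun y : ModelSpace N I => y.1 p :=
  (measurable_pi_apply p).comp measurable_subtype_coe

theorem generateFrom_coord : instMeasurableSpace (N := N) (I := I) =
    MeasurableSpace.generateFrom
      {S | ∃ (p : I × ℕ) (B : Set ℝ), MeasurableSet B ∧ (fun y => y.1 p) ⁻¹' B = S} := by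
  apply le_antisymm
  · change MeasurableSpace.comap Subtype.val MeasurableSpace.pi ≤ _
    rw [MeasurableSpace.pi_eq_generateFrom_projections, MeasurableSpace.comap_generateFrom]
    refine MeasurableSpace.generateFrom_mono ?_
    rintro _ ⟨_, ⟨p, B, hB, rfl⟩, rfl⟩
    exact ⟨p, B, hB, rfl⟩
  · refine MeasurableSpace.generateFrom_le ?_
    rintro _ ⟨p, B, hB, rfl⟩
    exact measurable_coord p hB

theorem measurable_of_coord {Z : Type*} [MeasurableSpace Z] {f : Z → ModelSpace N I}
    (h : ∀ p, Measurable fun z => (f z).1 p) : Measurable f := by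
  rw [measurable_iff_comap_le, generateFrom_coord, MeasurableSpace.comap_generateFrom]
  refine MeasurableSpace.generateFrom_le ?_
  rintro _ ⟨_, ⟨p, B, hB, rfl⟩, rfl⟩
  exact h p hB

instance [Countable I] : StandardBorelSpace (ModelSpace N I) := by
  have : IsClosed {y : I × ℕ → ℝ |
      ∀ i n m, |y (i, n) - y (i, m)| ≤ N (denseSeq G n * (denseSeq G m)⁻¹)} := by
    simp only [ofPred_forall]
    refine isClosed_iInter fun i => isClosed_iInter fun n => isClosed_iInter fun m => ?_
    exact isClosed_le (by fun_prop) continuous_const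
  exact this.measurableSet.standardBorel

/-- The value at `h` of the function with index `i`, by McShane's extension formula. -/
noncomputable def ext (y : ModelSpace N I) (i : I) (h : G) : ℝ :=
  ⨅ m, (y.1 (i, m) + N (denseSeq G m * h⁻¹))

theorem bddBelow_ext (y : ModelSpace N I) (i : I) (h : G) :
    BddBelow (range fun m => y.1 (i, m) + N (denseSeq G m * h⁻¹)) := by
  refine ⟨y.1 (i, 0) - N (denseSeq G 0 * h⁻¹), ?_⟩
  rintro _ ⟨m, rfl⟩
  have h1 := (le_abs_self _).trans (y.2 i 0 m)
  have h2 := map_mul_le_add N (denseSeq G 0 * h⁻¹) (h * (denseSeq G m)⁻¹)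
  rw [mul_assoc, inv_mul_cancel_left, ← map_inv_eq_map N (h * _), mul_inv_rev, inv_inv] at h2
  dsimp only
  linarith

theorem ext_denseSeq (y : ModelSpace N I) (i : I) (n : ℕ) :
    y.ext i (denseSeq G n) = y.1 (i, n) := by
  apply le_antisymm
  · have := ciInf_le (y.bddBelow_ext i (denseSeq G n)) n
    rwa [mul_inv_cancel, map_one_eq_zero, add_zero] at this
  · refine le_ciInf fun m => ?_
    have h1 := (le_abs_self _).trans (y.2 i n m)
    rw [← map_inv_eq_map N, mul_inv_rev, inv_inv] at h1
    linarith

theorem abs_ext_sub_le (y : ModelSpace N I) (i : I) (g h : G) :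
    |y.ext i g - y.ext i h| ≤ N (g * h⁻¹) := by
  have key : ∀ g h : G, y.ext i g ≤ y.ext i h + N (g * h⁻¹) := fun g h => by
    rw [← sub_le_iff_le_add]
    refine le_ciInf fun m => ?_
    rw [sub_le_iff_le_add]
    refine (ciInf_le (y.bddBelow_ext i g) m).trans ?_
    have := map_mul_le_add N (denseSeq G m * h⁻¹) (h * g⁻¹)
    rw [mul_assoc, inv_mul_cancel_left, ← map_inv_eq_map N (h * _), mul_inv_rev, inv_inv] at this
    linarith
  have h1 := key g h
  have h2 := key h g
  rw [← map_inv_eq_map N (h * g⁻¹), mul_inv_rev, inv_inv] at h2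
  rw [abs_sub_le_iff]
  constructor <;> linarith

variable [IsTopologicalGroup G]

theorem ext_eq (hN : IsLength N) (y : ModelSpace N I) (i : I) {φ : G → ℝ}
    (hφ : ∀ g h, |φ g - φ h| ≤ N (g * h⁻¹)) (h : ∀ n, y.1 (i, n) = φ (denseSeq G n)) :
    y.ext i = φ := by
  refine (denseRange_denseSeq G).equalizer
    (hN.continuous_of_abs_sub_le (y.abs_ext_sub_le i)) (hN.continuous_of_abs_sub_le hφ) ?_
  funext n
  simp [ext_denseSeq, h]

/-- The action of `G` on the model space: the functions are translated on the right. -/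
noncomputable def smul (k : G) (y : ModelSpace N I) : ModelSpace N I :=
  ⟨fun p => y.ext p.1 (denseSeq G p.2 * k), fun i n m => by
    refine (y.abs_ext_sub_le i _ _).trans_eq ?_
    simp [mul_assoc]⟩

theorem ext_smul (hN : IsLength N) (k : G) (y : ModelSpace N I) (i : I) (h : G) :
    (y.smul k).ext i h = y.ext i (h * k) := by
  refine congrFun (ext_eq (φ := fun h => y.ext i (h * k)) hN _ i (fun g h => ?_) fun n => rfl) h
  simpa [mul_assoc] using y.abs_ext_sub_le i (g * k) (h * k)

/-- `ModelSpace.smul` as a group action. It is not an instance, because the action law needs `N` to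
define the topology of `G`. -/
@[reducible]
noncomputable def mulAction (hN : IsLength N) : MulAction G (ModelSpace N I) where
  smul := smul
  one_smul y := Subtype.ext <| funext fun p => by
    change y.ext p.1 (denseSeq G p.2 * 1) = y.1 p
    rw [mul_one, ext_denseSeq]
  mul_smul k l y := Subtype.ext <| funext fun p => by
    change y.ext p.1 (denseSeq G p.2 * (k * l)) = (y.smul l).ext p.1 (denseSeq G p.2 * k)
    rw [ext_smul hN, mul_assoc]

variable [MeasurableSpace G] [BorelSpace G]

theorem measurable_ext (hN : IsLength N) (i : I) :
    Measurable fun p : G × ModelSpace N I => p.2.ext i p.1 := by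
  refine Measurable.iInf fun m => ((measurable_coord _).comp measurable_snd).add ?_
  have : Continuous fun h : G => N (denseSeq G m * h⁻¹) := hN.continuous.comp (by fun_prop)
  exact this.measurable.comp measurable_fst

theorem measurable_smul (hN : IsLength N) :
    Measurable fun p : G × ModelSpace N I => p.2.smul p.1 := by
  refine measurable_of_coord fun q => ?_
  have h : Measurable fun p : G × ModelSpace N I => (denseSeq G q.2 * p.1, p.2) :=
    (measurable_fst.const_mul _).prodMk measurable_snd
  exact (measurable_ext hN q.1).comp h

theorem measurable_smul_const (hN : IsLength N) (k : G) :
    Measurable fun y : ModelSpace N I => y.smul k := by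
  have h : Measurable fun y : ModelSpace N I => (k, y) := measurable_const.prodMk measurable_id
  exact (measurable_smul hN).comp h

end ModelSpace

end ModelSpace

/-! ### Pulling back measure algebras -/

namespace MeasureAlgebra

variable {X : Type u} [MeasurableSpace X] {μ : Measure X} {Y : Type w} [MeasurableSpace Y]
  {ν : Measure Y} {f : X → Y}

/-- A measure-preserving map, as an order embedding of measure algebras in the other direction. -/
noncomputable def pullback (hf : MeasurePreserving f μ ν) : MeasureAlgebra ν ↪o MeasureAlgebra μ :=
  OrderEmbedding.ofMapLEIff
    (Quotient.map (fun s => ⟨f ⁻¹' s, hf.measurable s.2⟩)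
      fun _ _ h => hf.quasiMeasurePreserving.ae_eq_comp h) fun a b => by
    induction a using ind with
    | h s hs =>
      induction b using ind with
      | h t ht =>
        change f ⁻¹' s ≤ᵐ[μ] f ⁻¹' t ↔ s ≤ᵐ[ν] t
        rw [ae_le_set, ae_le_set, ← preimage_sdiff,
          hf.measure_preimage (hs.diff ht).nullMeasurableSet]

theorem pullback_mk (hf : MeasurePreserving f μ ν) {s : Set Y} (hs : MeasurableSet s) :
    pullback hf (mk ν s hs) = mk μ (f ⁻¹' s) (hf.measurable hs) := rfl

theorem meas_pullback (hf : MeasurePreserving f μ ν) (a : MeasureAlgebra ν) :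
    (pullback hf a).meas = a.meas := by
  induction a using ind with
  | h s hs =>
    rw [pullback_mk, meas_mk, meas_mk, hf.measure_preimage hs.nullMeasurableSet]

theorem isSigmaSubalgebra_range_pullback (hf : MeasurePreserving f μ ν) :
    IsSigmaSubalgebra (range (pullback hf)) where
  bot_mem := ⟨⊥, rfl⟩
  compl_mem := by
    rintro _ ⟨a, rfl⟩
    induction a using ind with
    | h s hs => exact ⟨mk ν sᶜ hs.compl, rfl⟩
  union_mem a ha := by
    choose b hb using ha
    obtain rfl : (fun n => pullback hf (b n)) = a := funext hb
    refine ⟨mk ν (⋃ n, (b n).rep) (MeasurableSet.iUnion fun n => (b n).measurableSet_rep), ?_⟩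
    rw [pullback_mk]
    simp only [preimage_iUnion]
    rw [mk_iUnion fun n => hf.measurable (b n).measurableSet_rep]
    congr 1
    funext n
    rw [← pullback_mk hf (b n).measurableSet_rep, mk_rep]

end MeasureAlgebra

/-! ### Constructing a spatial model -/

namespace BooleanAction

open TopologicalSpace

variable {G : Type v} [Group G] [TopologicalSpace G] [PolishSpace G]
  {X : Type u} [MeasurableSpace X] {μ : Measure X} (β : BooleanAction G μ)
  {N : GroupSeminorm G} {I : Type u}

/-- The map sending a point `x` to the family of functions `g ↦ orbitFun a g x`. -/
noncomputable def modelMap (N : GroupSeminorm G) (a : I → MeasureAlgebra μ) (x : X) :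
    ModelSpace N I :=
  ⟨fun p => β.orbitFun N (a p.1) (denseSeq G p.2) x, fun i _ _ => β.abs_orbitFun_sub_le (a i) _ _ x⟩

theorem measurable_modelMap (a : I → MeasureAlgebra μ) : Measurable (β.modelMap N a) :=
  ModelSpace.measurable_of_coord fun p => β.measurable_orbitFun (a p.1) _

variable [IsTopologicalGroup G]

theorem ext_modelMap (hN : IsLength N) (a : I → MeasureAlgebra μ) (x : X) (i : I) (g : G) :
    (β.modelMap N a x).ext i g = β.orbitFun N (a i) g x :=
  congrFun (ModelSpace.ext_eq (φ := fun g => β.orbitFun N (a i) g x) hN _ i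
    (fun g h => β.abs_orbitFun_sub_le (a i) g h x) fun _ => rfl) g

variable [MeasurableSpace G] [BorelSpace G]

theorem measurable_smul_modelMap (hN : IsLength N) (a : I → MeasureAlgebra μ) (k : G) :
    Measurable fun x => (β.modelMap N a x).smul k :=
  (ModelSpace.measurable_smul_const hN k).comp (β.measurable_modelMap a)

/-- The model map intertwines the boolean action with the action on the model space. -/
theorem act_mk_modelMap (hN : IsLength N) (a : I → MeasureAlgebra μ) (k : G)
    {S : Set (ModelSpace N I)} (hS : MeasurableSet S) :
    β.act k⁻¹ (mk μ (β.modelMap N a ⁻¹' S) (β.measurable_modelMap a hS)) =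
      mk μ ((fun x => (β.modelMap N a x).smul k) ⁻¹' S)
        (β.measurable_smul_modelMap hN a k hS) := by
  refine map_mk_preimage (β k⁻¹).1 (β.measurable_modelMap a) (β.measurable_smul_modelMap hN a k)
    ModelSpace.generateFrom_coord ?_ hS
  rintro _ ⟨p, B, hB, rfl⟩ -
  refine (β.act_mk_orbitFun hN (a p.1) (denseSeq G p.2) k hB).trans (mk_eq_mk.2 ?_)
  have : ∀ x, ((β.modelMap N a x).smul k).1 p = β.orbitFun N (a p.1) (denseSeq G p.2 * k) x :=
    fun x => β.ext_modelMap hN a x p.1 _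
  simp only [preimage_preimage, this]
  rfl

/-- If the stable elements generate, countably many of them do, and the corresponding family of
orbit functions maps `X` onto a spatial model. -/
theorem admitsSpatialModel_of_stableAlgebra_eq_univ [MeasurableSpace.CountablyGenerated X]
    [IsProbabilityMeasure μ] {U : ℕ → Set G} (hU : IsSymmetricBasis U)
    (h : β.stableAlgebra U = univ) : β.AdmitsSpatialModel := by
  obtain ⟨N, hN⟩ := exists_isLength G
  obtain ⟨C, hCs, hCc, hC⟩ := exists_countable_sigmaGenerated_eq_univ h
  have := hCc.to_subtype
  let a : C → MeasureAlgebra μ := Subtype.val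
  let π : X → ModelSpace N C := β.modelMap N a
  have hπ : Measurable π := β.measurable_modelMap a
  have hπ' : MeasurePreserving π μ (μ.map π) := hπ.measurePreserving μ
  have hprob : IsProbabilityMeasure (μ.map π) := Measure.isProbabilityMeasure_map hπ.aemeasurable
  -- Each generator `b` is `{F_1 ≤ 0}`, and `F_1` factors through `π` as evaluation at `1`.
  have hsurj : Function.Surjective (pullback hπ') := by
    rw [← range_eq_univ, ← univ_subset_iff, ← hC]
    refine sigmaGenerated_subset (isSigmaSubalgebra_range_pullback hπ') fun b hb => ?_
    rcases hCs hb with rfl | hstable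
    · exact (isSigmaSubalgebra_range_pullback hπ').bot_mem
    · rw [← hstable, β.tilde_eq_mk hN hU]
      have hm : Measurable fun y : ModelSpace N C => y.ext ⟨b, hb⟩ 1 :=
        (ModelSpace.measurable_ext hN _).comp (measurable_const.prodMk measurable_id)
      refine ⟨mk _ _ (hm (measurableSet_Iic (a := 0))), ?_⟩
      rw [pullback_mk]
      refine mk_eq_mk.2 (Eventually.of_forall fun x => ?_)
      change ((β.modelMap N a x).ext ⟨b, hb⟩ 1 ≤ 0) = (β.orbitFun N b 1 x ≤ 0)
      rw [β.ext_modelMap hN]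
  let σ : SpatialAction G (μ.map π) :=
    { ModelSpace.mulAction hN with
      measurable_act := ModelSpace.measurable_smul hN
      preserves := fun g => by
        have hg : Measurable fun y : ModelSpace N C => y.smul g :=
          ModelSpace.measurable_smul_const hN g
        refine ⟨hg, Measure.ext fun S hS => ?_⟩
        have h1 := congrArg meas (β.act_mk_modelMap hN a g hS)
        rw [show meas (β.act g⁻¹ _) = _ from (β g⁻¹).2 _, meas_mk, meas_mk] at h1
        change Measure.map (fun y : ModelSpace N C => y.smul g) (μ.map π) S = _
        rw [Measure.map_apply hg hS, Measure.map_apply hπ hS, Measure.map_apply hπ (hg hS)]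
        exact h1.symm }
  let φ : MeasureAlgebra (μ.map π) ≃o MeasureAlgebra μ := RelIso.ofSurjective (pullback hπ') hsurj
  have hφ : ∀ b, φ b = pullback hπ' b := fun b => rfl
  refine ⟨ModelSpace N C, inferInstance, inferInstance, μ.map π, hprob, σ, φ.symm,
    fun b => ?_, fun g b => ?_⟩
  · rw [← meas_pullback hπ', ← hφ, φ.apply_symm_apply]
  · obtain ⟨c, rfl⟩ := φ.surjective b
    rw [φ.symm_apply_apply, φ.symm_apply_eq]
    induction c using ind with
    | h S hS =>
      have h1 := β.act_mk_modelMap hN a g⁻¹ hS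
      rw [inv_inv] at h1
      exact h1

end BooleanAction

end

section

open MeasureAlgebra

/-! ### Vaught transforms -/

section Vaught

open TopologicalSpace

variable {G : Type v} [TopologicalSpace G] [MeasurableSpace G] [BorelSpace G]
  [SecondCountableTopology G]

theorem isMeagre_of_subset {Z : Type*} [TopologicalSpace Z] {s t : Set Z} (hs : IsMeagre s)
    (h : t ⊆ s) : IsMeagre t :=
  hs.mono h

/-- A nonmeagre Borel subset of an open set `U` is comeagre in some basic open subset of `U`. -/
theorem exists_isMeagre_diff_of_not_isMeagre {Q U : Set G} (hQ : MeasurableSet Q) (hU : IsOpen U)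
    (hQU : Q ⊆ U) (h : ¬ IsMeagre Q) : ∃ V ∈ countableBasis G, V ⊆ U ∧ IsMeagre (V \ Q) := by
  obtain ⟨O, hO, hQO⟩ := hQ.residualEq_isOpen
  have h1 : IsMeagre (Q \ O) := by
    filter_upwards [hQO] with x hx
    exact fun hx' => hx'.2 (hx.mp hx'.1)
  have h2 : IsMeagre (O \ Q) := by
    filter_upwards [hQO] with x hx
    exact fun hx' => hx'.2 (hx.mpr hx'.1)
  obtain ⟨q, hq⟩ : (Q ∩ O).Nonempty := by
    rw [nonempty_iff_ne_empty]
    intro h3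
    refine h (isMeagre_of_subset h1 fun x hx => ⟨hx, fun hxO => ?_⟩)
    exact (h3 ▸ (⟨hx, hxO⟩ : x ∈ Q ∩ O) : x ∈ (∅ : Set G))
  obtain ⟨V, hV, -, hVU⟩ := (isBasis_countableBasis G).exists_subset_of_mem_open
    (⟨hQU hq.1, hq.2⟩ : q ∈ U ∩ O) (hU.inter hO)
  exact ⟨V, hV, hVU.trans inter_subset_left,
    isMeagre_of_subset h2 (sdiff_subset_sdiff_left (hVU.trans inter_subset_right))⟩

variable [BaireSpace G] {Y : Type w} [MeasurableSpace Y]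

/-- The category quantifier preserves Borel sets: for a Borel set `S` in a product, the set of
points over which `S` has a section that is nonmeagre in `U` is Borel. -/
theorem measurableSet_setOf_not_isMeagre {S : Set (G × Y)} (hS : MeasurableSet S) {U : Set G}
    (hU : IsOpen U) : MeasurableSet {y | ¬ IsMeagre (U ∩ {g | (g, y) ∈ S})} := by
  have hsec : ∀ {S : Set (G × Y)}, MeasurableSet S → ∀ y, MeasurableSet {g | (g, y) ∈ S} :=
    fun hS y => measurable_prodMk_right hS
  revert U
  have hS' := hS
  rw [← generateFrom_prod] at hS'
  induction S, hS' using MeasurableSpace.generateFrom_induction with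
  | hC S hSC _ =>
    intro U _
    obtain ⟨s, hs, t, ht, rfl⟩ := hSC
    by_cases h : IsMeagre (U ∩ s)
    · convert MeasurableSet.empty using 1
      refine eq_empty_iff_forall_notMem.2 fun y hy =>
        hy (isMeagre_of_subset h fun g hg => ⟨hg.1, hg.2.1⟩)
    · convert show MeasurableSet t from ht using 1
      ext y
      constructor
      · intro hy
        obtain ⟨g, hg⟩ := nonempty_of_not_isMeagre hy
        exact hg.2.2
      · exact fun hy hm => h (isMeagre_of_subset hm fun g hg => ⟨hg.1, hg.2, hy⟩)
  | empty =>
    intro U _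
    convert MeasurableSet.empty using 1
    refine eq_empty_iff_forall_notMem.2 fun y hy => hy ?_
    convert IsMeagre.empty using 1
    simp
  | compl S hSg ih =>
    intro U hU
    rw [generateFrom_prod] at hSg
    -- By the Baire property, a section of `Sᶜ` is nonmeagre in `U` if and only if the section of
    -- `S` is meagre in some basic open subset of `U`.
    have h1 : {y | ¬ IsMeagre (U ∩ {g | (g, y) ∈ Sᶜ})} =
        ⋃ V : {V // V ∈ countableBasis G ∧ V ⊆ U},
          {y | ¬ IsMeagre ((V : Set G) ∩ {g | (g, y) ∈ S})}ᶜ := by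
      ext y
      simp only [mem_iUnion, mem_compl_iff, mem_ofPred_eq, not_not]
      constructor
      · intro hy
        obtain ⟨V, hV, hVU, hm⟩ := exists_isMeagre_diff_of_not_isMeagre
          (hU.measurableSet.inter (hsec hSg.compl y)) hU inter_subset_left hy
        exact ⟨⟨V, hV, hVU⟩, isMeagre_of_subset hm fun g hg => ⟨hg.1, fun hg' => hg'.2 hg.2⟩⟩
      · rintro ⟨⟨V, hV, hVU⟩, hm⟩ hm'
        refine not_isMeagre_of_isOpen (isOpen_of_mem_countableBasis hV)
          (nonempty_of_mem_countableBasis hV) (isMeagre_of_subset (hm.union hm') fun g hg => ?_)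
        by_cases hgS : (g, y) ∈ S
        · exact Or.inl ⟨hg, hgS⟩
        · exact Or.inr ⟨hVU hg, hgS⟩
    have : Countable {V // V ∈ countableBasis G ∧ V ⊆ U} :=
      ((countable_countableBasis G).mono fun V hV => hV.1).to_subtype
    rw [h1]
    exact MeasurableSet.iUnion fun V =>
      (ih hSg (isOpen_of_mem_countableBasis V.2.1)).compl
  | iUnion S hSg ih =>
    intro U hU
    rw [generateFrom_prod] at hSg
    have h1 : {y | ¬ IsMeagre (U ∩ {g | (g, y) ∈ ⋃ n, S n})} =
        ⋃ n, {y | ¬ IsMeagre (U ∩ {g | (g, y) ∈ S n})} := by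
      ext y
      simp only [mem_iUnion, mem_ofPred_eq]
      rw [← not_forall, not_iff_not]
      constructor
      · exact fun h n => isMeagre_of_subset h fun g hg => ⟨hg.1, n, hg.2⟩
      · refine fun h => isMeagre_of_subset (isMeagre_iUnion h) fun g hg => ?_
        obtain ⟨n, hn⟩ := hg.2
        exact mem_iUnion.2 ⟨n, hg.1, hn⟩
    rw [h1]
    exact MeasurableSet.iUnion fun n => ih n (hSg n) hU

/-- Countably many measurable sets that separate points generate the measure algebra. -/
theorem MeasureAlgebra.IsSigmaSubalgebra.eq_univ_of_separating [StandardBorelSpace Y]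
    {ν : Measure Y} {S : Set (MeasureAlgebra ν)} (hS : IsSigmaSubalgebra S) {C : Set (Set Y)}
    (hC : C.Countable) (hm : ∀ s ∈ C, MeasurableSet s)
    (hsep : ∀ x y, (∀ s ∈ C, x ∈ s ↔ y ∈ s) → x = y)
    (h : ∀ s ∈ C, ∀ hs : MeasurableSet s, MeasureAlgebra.mk ν s hs ∈ S) : S = univ := by
  rename_i m _
  -- The identity from `Y` to `Y` with the σ-algebra generated by `C` is a Borel embedding.
  have hgen : m = MeasurableSpace.generateFrom C := by
    have hle := MeasurableSpace.generateFrom_le hm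
    refine le_antisymm (fun s hs => ?_) hle
    have hcs : @MeasurableSpace.CountablySeparated Y (MeasurableSpace.generateFrom C) :=
      @MeasurableSpace.CountablySeparated.mk Y (MeasurableSpace.generateFrom C)
        ⟨C, hC, fun s hs => MeasurableSpace.measurableSet_generateFrom hs,
          fun x _ y _ hxy => hsep x y hxy⟩
    have himage := @MeasurableSet.image_of_measurable_injOn Y Y (MeasurableSpace.generateFrom C) s
      id hcs m _ hs (measurable_id'' hle) Function.injective_id.injOn
    rwa [image_id] at himage
  refine eq_univ_of_forall fun a => ?_
  rw [← a.mk_rep]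
  exact hS.mk_preimage_mem (f := id) measurable_id hgen h a.measurableSet_rep

variable [Group G] [MulAction G Y]

/-- The Vaught transform of `A` over `U`: the points carried into `A` by nonmeagrely many elements
of `U`. -/
def vaught (A : Set Y) (U : Set G) : Set Y := {y | ¬ IsMeagre (U ∩ {g | g • y ∈ A})}

theorem measurableSet_vaught (hact : Measurable fun p : G × Y => p.1 • p.2) {A : Set Y}
    (hA : MeasurableSet A) {U : Set G} (hU : IsOpen U) : MeasurableSet (vaught A U) :=
  measurableSet_setOf_not_isMeagre (hact hA) hU

/-- The Vaught transforms of a generating family over basic open sets separate points: if `x` and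
`y` belong to the same transforms, then for each generator `A` the elements `g` for which exactly
one of `g x`, `g y` lies in `A` form a meagre set, so `g x = g y` for some `g`. -/
theorem eq_of_mem_vaught_iff
    (hact : Measurable fun p : G × Y => p.1 • p.2) {K : Set (Set Y)} (hK : K.Countable)
    (hgen : ∀ x y, (∀ s ∈ K, x ∈ s ↔ y ∈ s) → x = y) (hKm : ∀ s ∈ K, MeasurableSet s) {x y : Y}
    (h : ∀ A ∈ K, ∀ V ∈ countableBasis G, x ∈ vaught A V ↔ y ∈ vaught A V) : x = y := by
  have hsec : ∀ A ∈ K, ∀ y : Y, MeasurableSet {g : G | g • y ∈ A} := fun A hA y =>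
    (hact.comp measurable_prodMk_right) (hKm A hA)
  have key : ∀ x y : Y, (∀ A ∈ K, ∀ V ∈ countableBasis G, x ∈ vaught A V ↔ y ∈ vaught A V) →
      ∀ A ∈ K, IsMeagre ({g : G | g • x ∈ A} \ {g : G | g • y ∈ A}) := by
    intro x y h A hA
    by_contra hcon
    obtain ⟨V, hV, -, hm⟩ := exists_isMeagre_diff_of_not_isMeagre
      ((hsec A hA x).diff (hsec A hA y)) isOpen_univ (subset_univ _) hcon
    have hy : y ∉ vaught A V := fun hy =>
      hy (isMeagre_of_subset hm fun g hg => ⟨hg.1, fun hg' => hg'.2 hg.2⟩)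
    rw [← h A hA V hV] at hy
    refine not_isMeagre_of_isOpen (isOpen_of_mem_countableBasis hV)
      (nonempty_of_mem_countableBasis hV)
      (isMeagre_of_subset ((not_not.1 hy).union hm) fun g hg => ?_)
    by_cases hgx : g • x ∈ A
    · exact Or.inl ⟨hg, hgx⟩
    · exact Or.inr ⟨hg, fun hg' => hgx hg'.1⟩
  have hm : IsMeagre (⋃ A ∈ K, ({g : G | g • x ∈ A} \ {g : G | g • y ∈ A}) ∪
      ({g : G | g • y ∈ A} \ {g : G | g • x ∈ A})) :=
    isMeagre_biUnion hK fun A hA => (key x y h A hA).union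
      (key y x (fun A hA V hV => (h A hA V hV).symm) A hA)
  obtain ⟨g, hg⟩ : (⋃ A ∈ K, ({g : G | g • x ∈ A} \ {g : G | g • y ∈ A}) ∪
      ({g : G | g • y ∈ A} \ {g : G | g • x ∈ A}))ᶜ.Nonempty := by
    rw [nonempty_compl]
    intro hu
    rw [hu] at hm
    exact not_isMeagre_of_isOpen isOpen_univ univ_nonempty hm
  refine MulAction.injective g (hgen _ _ fun A hA => ?_)
  simp only [mem_compl_iff, mem_iUnion, not_exists] at hg
  have := hg A hA
  simp only [mem_union, Set.mem_sdiff, mem_ofPred_eq] at this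
  tauto

end Vaught

/-! ### Spatial actions are generated by stable elements -/

namespace BooleanAction

open TopologicalSpace

variable {G : Type v} [Group G] [TopologicalSpace G] [IsTopologicalGroup G] [PolishSpace G]
  [MeasurableSpace G] [BorelSpace G] {X : Type u} [MeasurableSpace X] {μ : Measure X}
  (β : BooleanAction G μ)

/-- In a spatial model, `A^{ΔU}` (the Vaught transform of `A` over `U`) is the union of the
`A^{ΔV}` over basic open sets `V` with `V B⁻¹ ⊆ U` for some ball `B`. As `h A^{ΔV} = A^{ΔVh⁻¹}`, it
is also the union of the sweeps of the `A^{ΔV}` by these balls, and sweeps by balls are level sets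
of `G`-continuous functions. -/
theorem gContinuousAlgebra_eq_univ_of_admitsSpatialModel (h : β.AdmitsSpatialModel) :
    β.gContinuousAlgebra = univ := by
  obtain ⟨Y, _, _, ν, _, σ, φ, -, hφ⟩ := h
  obtain ⟨N, hN⟩ := exists_isLength G
  let _ : MulAction G Y := σ.toMulAction
  have hact : Measurable fun p : G × Y => p.1 • p.2 := σ.measurable_act
  have hS := isSigmaSubalgebra_sigmaGenerated
    {a | ∃ f : Lp ℝ ∞ μ, β.GContinuous f ∧ ∃ (B : Set ℝ) (hB : MeasurableSet B), a = level f B hB}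
  change IsSigmaSubalgebra β.gContinuousAlgebra at hS
  -- It suffices to find the Vaught transforms in the image of the algebra under `φ`.
  have hS' : IsSigmaSubalgebra {b | φ.symm b ∈ β.gContinuousAlgebra} :=
    { bot_mem := by
        rw [mem_ofPred_eq, φ.symm.map_bot]
        exact hS.bot_mem
      compl_mem := fun b hb => by
        rw [mem_ofPred_eq, map_compl']
        exact hS.compl_mem _ hb
      union_mem := fun b hb => by
        rw [mem_ofPred_eq, orderIso_union]
        exact hS.union_mem _ hb }
  have hsweep : ∀ (A : Set Y) (hA : MeasurableSet A) (U V : Set G) (hU : IsOpen U) (hV : IsOpen V)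
      (r : ℝ), (∀ v ∈ V, ∀ h, N h < r → v * h⁻¹ ∈ U) →
      β.sweep {γ | N γ < r} (φ.symm (mk ν (vaught A V) (measurableSet_vaught hact hA hV))) ≤
        φ.symm (mk ν (vaught A U) (measurableSet_vaught hact hA hU)) := by
    intro A hA U V hU hV r hr
    refine β.sweep_le fun k hk => ?_
    rw [← φ.le_iff_le, hφ, φ.apply_symm_apply, φ.apply_symm_apply]
    refine mk_le_of_subset (fun y hy hm => hy ?_)
    refine isMeagre_of_subset
      (hm.preimage_of_isOpenMap (continuous_mul_const k⁻¹) (isOpenMap_mul_right k⁻¹))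
      fun g hg => ⟨hr g hg.1 k hk, ?_⟩
    rw [mem_ofPred_eq, mul_smul]
    exact hg.2
  have hmem : ∀ (A : Set Y) (hA : MeasurableSet A) (U : Set G) (hU : IsOpen U),
      φ.symm (mk ν (vaught A U) (measurableSet_vaught hact hA hU)) ∈ β.gContinuousAlgebra := by
    intro A hA U hU
    -- Pairs of a basic open set `V` and a ball `B` with `V B⁻¹ ⊆ U`.
    let J := {p : countableBasis G × ℕ //
      ∀ v ∈ (p.1 : Set G), ∀ h, N h < 1 / ((p.2 : ℝ) + 1) → v * h⁻¹ ∈ U}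
    have : Countable (countableBasis G) := (countable_countableBasis G).to_subtype
    have hV : ∀ j : J, IsOpen (j.1.1 : Set G) := fun j => isOpen_of_mem_countableBasis j.1.1.2
    have hcover : vaught A U = ⋃ j : J, vaught A (j.1.1 : Set G) := by
      apply Subset.antisymm
      · intro y hy
        by_contra hcon
        simp only [mem_iUnion, not_exists] at hcon
        refine hy (isMeagre_of_subset (isMeagre_iUnion fun j => not_not.1 (hcon j)) fun g hg => ?_)
        have hc : Continuous fun p : G × G => p.1 * p.2⁻¹ := by fun_prop
        have h1 : (fun p : G × G => p.1 * p.2⁻¹) ⁻¹' U ∈ 𝓝 g ×ˢ 𝓝 (1 : G) := by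
          rw [← nhds_prod_eq]
          exact hc.continuousAt.preimage_mem_nhds (by simpa using hU.mem_nhds hg.1)
        obtain ⟨⟨V, r⟩, ⟨⟨hV, hgV⟩, hr⟩, hVr⟩ :=
          (((isBasis_countableBasis G).nhds_hasBasis).prod hN.hasBasis).mem_iff.1 h1
        obtain ⟨n, hn⟩ := exists_nat_one_div_lt (show (0 : ℝ) < r from hr)
        exact mem_iUnion.2 ⟨⟨(⟨V, hV⟩, n), fun v hv h hh =>
          hVr (show (v, h) ∈ V ×ˢ {g | N g < r} from ⟨hv, lt_trans hh hn⟩)⟩, hgV, hg.2⟩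
      · refine iUnion_subset fun j y hy hm => hy (isMeagre_of_subset hm fun g hg => ⟨?_, hg.2⟩)
        have := j.2 g hg.1 1 (by rw [map_one_eq_zero]; positivity)
        simpa using this
    have hU' : φ.symm (mk ν (vaught A U) (measurableSet_vaught hact hA hU)) =
        union fun j : J =>
          φ.symm (mk ν (vaught A (j.1.1 : Set G)) (measurableSet_vaught hact hA (hV j))) := by
      rw [← orderIso_union, ← mk_iUnion]
      simp only [hcover]
    have hU'' : φ.symm (mk ν (vaught A U) (measurableSet_vaught hact hA hU)) =
        union fun j : J => β.sweep {γ | N γ < 1 / ((j.1.2 : ℝ) + 1)}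
          (φ.symm (mk ν (vaught A (j.1.1 : Set G)) (measurableSet_vaught hact hA (hV j)))) := by
      apply le_antisymm
      · rw [hU']
        refine (isLUB_union _).2 ?_
        rintro _ ⟨j, rfl⟩
        refine (β.le_sweep ?_ _).trans ((isLUB_union _).1 ⟨j, rfl⟩)
        rw [mem_ofPred_eq, map_one_eq_zero]
        positivity
      · refine (isLUB_union _).2 ?_
        rintro _ ⟨j, rfl⟩
        exact hsweep A hA U _ hU (hV j) _ j.2
    rw [hU'']
    refine hS.union_mem' _ fun j => β.sweep_ball_mem hN _ ?_
    rw [div_le_one (by positivity)]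
    exact le_add_of_nonneg_left j.1.2.cast_nonneg
  let K := MeasurableSpace.countableGeneratingSet Y
  have hK : K.Countable := MeasurableSpace.countable_countableGeneratingSet
  have hKm : ∀ A ∈ K, MeasurableSet A := fun A hA =>
    MeasurableSpace.measurableSet_countableGeneratingSet hA
  have hKsep : ∀ x y, (∀ s ∈ K, x ∈ s ↔ y ∈ s) → x = y := by
    have : @MeasurableSpace.SeparatesPoints Y (MeasurableSpace.generateFrom K) := by
      rw [MeasurableSpace.generateFrom_countableGeneratingSet]
      infer_instance
    exact MeasurableSpace.separating_of_generateFrom K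
  have huniv := hS'.eq_univ_of_separating
    (C := image2 vaught K (countableBasis G)) (hK.image2 (countable_countableBasis G) _)
    (by
      rintro _ ⟨A, hA, V, hV, rfl⟩
      exact measurableSet_vaught hact (hKm A hA) (isOpen_of_mem_countableBasis hV))
    (fun x y hxy => eq_of_mem_vaught_iff (G := G) hact hK hKsep hKm fun A hA V hV =>
      hxy _ ⟨A, hA, V, hV, rfl⟩)
    (by
      rintro _ ⟨A, hA, V, hV, rfl⟩ _
      exact hmem A (hKm A hA) V (isOpen_of_mem_countableBasis hV))
  refine eq_univ_of_forall fun a => ?_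
  have := huniv ▸ mem_univ (φ a)
  rwa [mem_ofPred_eq, φ.symm_apply_apply] at this

end BooleanAction

end

end BooleanSystem

theorem mainTheorem2 {G : Type v} [Group G] [TopologicalSpace G] [IsTopologicalGroup G]
    [PolishSpace G] [MeasurableSpace G] [BorelSpace G]
    {X : Type u} [MeasurableSpace X] [StandardBorelSpace X]
    (μ : Measure X) [IsProbabilityMeasure μ]
    (β : BooleanSystem.BooleanAction G μ)
    (U : ℕ → Set G) (hU : BooleanSystem.IsSymmetricBasis U) :
    β.gContinuousAlgebra = β.stableAlgebra U ∧
      (β.AdmitsSpatialModel ↔ β.stableAlgebra U = Set.univ) := by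
  have h := β.gContinuousAlgebra_eq_stableAlgebra hU
  refine ⟨h, fun hm => ?_, β.admitsSpatialModel_of_stableAlgebra_eq_univ hU⟩
  rw [← h]
  exact β.gContinuousAlgebra_eq_univ_of_admitsSpatialModel hm
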